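/- All graphs are simple, unweighted and connected, and may be infinite; $d_G$ (abbreviated $ab = d_G(a,b)$) denotes the shortest-path metric of a graph $G$. For an integer $k$, a graph is $k$-chordal if it has no chordless (i.e. induced) cycle of length greater than $k$. For vertices $x,y,u,v$ of $G$ let $\delta_G(x,y,u,v)$ be the difference between the largest and the second largest (counted with multiplicity) of the three numbers $\frac{uv+xy}{2}$, $\frac{ux+vy}{2}$, $\frac{uy+vx}{2}$. For real $\delta$, the graph $G$ is $\delta$-hyperbolic if $\delta_G(x,y,u,v)\le\delta$ for all vertices $x,y,u,v$, and its hyperbolicity $\delta^*(G)$ is the minimum $\delta\in\{0,\frac12,1,\frac32,\dots\}$ such that $G$ is $\delta$-hyperbolic ($\infty$ if there is none). A subgraph $H$ of $G$ is isometric if $d_H(p,q)=d_G(p,q)$ for all vertices $p,q$ of $H$; $G$ contains a given graph as an isometric subgraph if some isometric subgraph of $G$ is isomorphic to it. Let $C_4$ be the $4$-cycle graph. Let $H_1$ be the graph with the eight vertices $x,a,u,c,y,d,v,b$ and with the following $13$ edges: the edges $xa,au,uc,cy,yd,dv,vb,bx$ of an $8$-cycle, the edges $ab,bd,dc,ca$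 of a $4$-cycle, and the edge $ad$. Let $H_2$ be the graph obtained from $H_1$ by adding the edge $bc$. **Corollary.** Every $4$-chordal graph $G$ is $1$-hyperbolic; moreover, $\delta^*(G)=1$ if and only if $G$ contains at least one of $C_4$, $H_1$ and $H_2$ as an isometric subgraph. -/

import Mathlib

open scoped ENNReal

namespace GraphHyp

variable {V W : Type*}

/-- `G` is `k`-chordal: it has no chordless cycle of length greater than `k`. -/
def IsKChordal (G : SimpleGraph V) (k : ℕ) : Prop :=
  ∀ (u : V) (p : G.Walk u u), p.IsCycle → p.IsChordless → p.length ≤ k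

/-- The largest of three real numbers. -/
def largest (r s t : ℝ) : ℝ := max r (max s t)

/-- The second largest of three real numbers, counted with multiplicity (their median). -/
def secondLargest (r s t : ℝ) : ℝ := max (min r s) (max (min s t) (min r t))

/-- `δ_G(x, y, u, v)`: the difference between the largest and the second largest of
`(uv + xy) / 2`, `(ux + vy) / 2` and `(uy + vx) / 2`, where `ab` is the distance of `a` and `b`. -/
noncomputable def defect (G : SimpleGraph V) (x y u v : V) : ℝ :=
  let r : ℝ := ((G.dist u v : ℝ) + (G.dist x y : ℝ)) / 2
  let s : ℝ := ((G.dist u x : ℝ) + (G.dist v y : ℝ)) / 2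
  let t : ℝ := ((G.dist u y : ℝ) + (G.dist v x : ℝ)) / 2
  largest r s t - secondLargest r s t

/-- `G` is `δ`-hyperbolic. -/
def IsHyperbolic (G : SimpleGraph V) (δ : ℝ) : Prop :=
  ∀ x y u v : V, defect G x y u v ≤ δ

/-- The hyperbolicity `δ^*(G)`: the least half integer `n / 2`, `n = 0, 1, 2, …`, such that `G` is
`(n / 2)`-hyperbolic, and `∞` if there is none. -/
noncomputable def hyperbolicity (G : SimpleGraph V) : ℝ≥0∞ :=
  sInf {δ : ℝ≥0∞ | ∃ n : ℕ, δ = (n : ℝ≥0∞) / 2 ∧ IsHyperbolic G ((n : ℝ) / 2)}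

/-- A subgraph of `G` is isometric if distances between its vertices, measured inside
the subgraph, agree with those of `G`. -/
def IsIsometric {G : SimpleGraph V} (H : G.Subgraph) : Prop :=
  ∀ u v : H.verts, H.coe.edist u v = G.edist (u : V) (v : V)

/-- `G` contains (a copy of) `H` as an isometric subgraph. -/
def ContainsIsometric (G : SimpleGraph V) (H : SimpleGraph W) : Prop :=
  ∃ S : G.Subgraph, IsIsometric S ∧ Nonempty (H ≃g S.coe)

/-- The graph `C₄`. -/
abbrev C4 : SimpleGraph (Fin 4) := SimpleGraph.cycleGraph 4

/-- The graph `H₁`. The vertices `0, …, 7` are `x, a, u, c, y, d, v, b`. The edges are those of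
the 8-cycle `x a u c y d v b`, those of the 4-cycle `a b d c`, and `ad`. -/
def H1 : SimpleGraph (Fin 8) :=
  SimpleGraph.fromEdgeSet
    {s(0, 1), s(1, 2), s(2, 3), s(3, 4), s(4, 5), s(5, 6), s(6, 7), s(7, 0),
      s(1, 7), s(7, 5), s(5, 3), s(3, 1), s(1, 5)}

/-- The graph `H₂`, which is `H₁` with the further edge `bc`: the vertices `a, b, c, d` form
a clique. -/
def H2 : SimpleGraph (Fin 8) :=
  SimpleGraph.fromEdgeSet
    {s(0, 1), s(1, 2), s(2, 3), s(3, 4), s(4, 5), s(5, 6), s(6, 7), s(7, 0),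
      s(1, 7), s(7, 5), s(5, 3), s(3, 1), s(1, 5), s(3, 7)}

end GraphHyp

namespace GraphHyp

open SimpleGraph

/-! ### Geodesics and chordless cycles as indexed walks -/

section Walks

variable {V : Type*} {G : SimpleGraph V}

/-! View `x`, `u`, `y`, `v` as a quadrangle with geodesic sides and diagonals `xy`, `uv`. Suppose no
two opposite sides come within distance 1. Cutting the corners by connectors of length at most 1, as
economically as possible, leaves a chordless cycle (unless its length is below 4), hence one of
length at most `k`. Two routes around it for each diagonal use every side remainder and connector
once and every middle segment twice, so twice the diagonal sum is at most the perimeter plus `k`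
(`two_mul_diagonals_le`).

For `k = 4` this bounds the excess of the diagonal sum over the larger sum of opposite sides by 2.
Opposite sides within distance 1 give the same bound by the triangle inequality. This is
1-hyperbolicity.

Hyperbolicity 1 then means that some excess is at least 2. A chordless 4-cycle is already an
isometric `C4`. Otherwise `G` is chordal and `k = 3` is too small for excess 2, so an edge `pq`
joins opposite sides, with all triangle inequalities tight. Chordality builds triangles on `pq` and
then on their outer edges, which gives `H1` or `H2` (`containsIsometric_of_adj`). Conversely, the
three graphs have excess 2 themselves, and isometric copies preserve it. -/

theorem mk_getVert_succ_mem_edges {u v : V} (p : G.Walk u v) {i : ℕ} (hi : i < p.length) :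
    s(p.getVert i, p.getVert (i + 1)) ∈ p.edges := by
  induction p generalizing i with
  | nil => simp at hi
  | cons h p ih =>
    cases i with
    | zero => simp
    | succ i =>
      simp only [Walk.length_cons] at hi
      simp only [Walk.getVert_cons_succ, Walk.edges_cons, List.mem_cons]
      exact Or.inr (ih (by omega))

theorem dist_getVert_of_length_eq_dist {u v : V} (p : G.Walk u v) (hp : p.length = G.dist u v)
    {i j : ℕ} (hij : i ≤ j) (hj : j ≤ p.length) :
    G.dist (p.getVert i) (p.getVert j) = j - i := by
  have h1 : (p.take j).length = G.dist u (p.getVert j) :=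
    length_eq_dist_of_subwalk hp (p.isSubwalk_take j)
  have h2 := length_eq_dist_of_subwalk h1 ((p.take j).isSubwalk_drop i)
  rw [Walk.drop_length, Walk.take_length, min_eq_left hj] at h2
  have h3 : (p.take j).getVert i = p.getVert i := by
    rw [Walk.take_getVert, min_eq_right hij]
  rw [h2, h3]

theorem dist_add_dist_of_mem_support {u v z : V} (p : G.Walk u v) (hp : p.length = G.dist u v)
    (hz : z ∈ p.support) : G.dist u z + G.dist z v = G.dist u v := by
  obtain ⟨n, rfl, hn⟩ := Walk.mem_support_iff_exists_getVert.1 hz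
  have h1 := dist_getVert_of_length_eq_dist p hp (Nat.zero_le n) hn
  have h2 := dist_getVert_of_length_eq_dist p hp hn le_rfl
  rw [Walk.getVert_zero] at h1
  rw [Walk.getVert_length] at h2
  omega

/-- A closed walk in which only cyclically consecutive vertices are equal or adjacent
is a chordless cycle, provided that it has length at least `4`. -/
theorem isCycle_and_isChordless {u : V} (w : G.Walk u u) (hL : 4 ≤ w.length)
    (h : ∀ i j, i < j → j < w.length →
      w.getVert i = w.getVert j ∨ G.Adj (w.getVert i) (w.getVert j) →
      j = i + 1 ∨ (i = 0 ∧ j + 1 = w.length)) :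
    w.IsCycle ∧ w.IsChordless := by
  have hadj : ∀ i, i < w.length → G.Adj (w.getVert i) (w.getVert (i + 1)) :=
    fun i hi => w.adj_getVert_succ hi
  have hend : w.getVert w.length = w.getVert 0 := by simp
  have hne : ∀ i j, i < j → j < w.length → w.getVert i ≠ w.getVert j := by
    intro i j hij hj he
    rcases h i j hij hj (Or.inl he) with rfl | ⟨rfl, hj'⟩
    · exact (hadj i (by omega)).ne he
    · have := hadj j hj
      rw [hj', hend] at this
      exact this.ne he.symm
  refine ⟨?_, ?_⟩
  · rw [Walk.isCycle_iff_isPath_tail_and_le_length]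
    refine ⟨(Walk.IsPath.getVert_injOn_iff _).1 ?_, by omega⟩
    have key : ∀ i j, i < j → j ≤ w.tail.length → w.tail.getVert i ≠ w.tail.getVert j := by
      intro i j hij hj
      have hl := w.length_tail_add_one (by rw [← Walk.length_eq_zero_iff]; omega)
      rw [Walk.getVert_tail, Walk.getVert_tail]
      rcases (show j + 1 < w.length ∨ j + 1 = w.length by omega) with hj' | hj'
      · exact hne _ _ (by omega) hj'
      · rw [hj', hend]
        exact (hne 0 (i + 1) (by omega) (by omega)).symm
    intro i hi j hj he
    simp only [Set.mem_ofPred_eq] at hi hj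
    rcases lt_trichotomy i j with hij | hij | hij
    · exact absurd he (key i j hij hj)
    · exact hij
    · exact absurd he.symm (key j i hij hi)
  · rw [Walk.isChordless_iff_forall_mem_edges]
    have norm : ∀ z ∈ w.support, ∃ i < w.length, w.getVert i = z := by
      intro z hz
      obtain ⟨n, rfl, hn⟩ := Walk.mem_support_iff_exists_getVert.1 hz
      rcases hn.lt_or_eq with hn | rfl
      · exact ⟨n, hn, rfl⟩
      · exact ⟨0, by omega, hend.symm⟩
    have key : ∀ i j, i < j → j < w.length → G.Adj (w.getVert i) (w.getVert j) →
        s(w.getVert i, w.getVert j) ∈ w.edges := by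
      intro i j hij hj ha
      rcases h i j hij hj (Or.inr ha) with rfl | ⟨rfl, hj'⟩
      · exact mk_getVert_succ_mem_edges w (by omega)
      · have := mk_getVert_succ_mem_edges w hj
        rwa [hj', hend, Sym2.eq_swap] at this
    intro a b ha hb hab
    obtain ⟨i, hi, rfl⟩ := norm a ha
    obtain ⟨j, hj, rfl⟩ := norm b hb
    rcases lt_trichotomy i j with hij | rfl | hij
    · exact key i j hij hj hab
    · exact absurd rfl hab.ne
    · rw [Sym2.eq_swap]
      exact key j i hij hi hab.symm

theorem IsKChordal.length_le {k : ℕ} (hG : IsKChordal G k) (hk : 3 ≤ k) {u : V} (w : G.Walk u u)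
    (h : ∀ i j, i < j → j < w.length →
      w.getVert i = w.getVert j ∨ G.Adj (w.getVert i) (w.getVert j) →
      j = i + 1 ∨ (i = 0 ∧ j + 1 = w.length)) :
    w.length ≤ k := by
  by_contra hlt
  obtain ⟨h1, h2⟩ := isCycle_and_isChordless w (by omega) h
  exact hlt (hG u w h1 h2)

end Walks

/-! ### The truncated geodesic quadrangle -/

section Quadrangle

variable {V : Type*} {G : SimpleGraph V}

/-- Closing up a geodesic octagon whose odd sides have length at most one. -/
theorem octagon_le {k : ℕ} (hc : G.Connected) (hG : IsKChordal G k) (hk : 3 ≤ k)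
    {a₀ b₀ a₁ b₁ a₂ b₂ a₃ b₃ : V}
    (h₁ : G.dist b₀ a₁ ≤ 1) (h₂ : G.dist b₁ a₂ ≤ 1) (h₃ : G.dist b₂ a₃ ≤ 1)
    (h₀ : G.dist b₃ a₀ ≤ 1)
    (opp₀ : ∀ r s, G.dist a₀ r + G.dist r b₀ = G.dist a₀ b₀ →
      G.dist a₂ s + G.dist s b₂ = G.dist a₂ b₂ → 2 ≤ G.dist r s)
    (opp₁ : ∀ r s, G.dist a₁ r + G.dist r b₁ = G.dist a₁ b₁ →
      G.dist a₃ s + G.dist s b₃ = G.dist a₃ b₃ → 2 ≤ G.dist r s)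
    (adj₁ : ∀ r s, G.dist a₀ r + G.dist r b₀ = G.dist a₀ b₀ →
      G.dist a₁ s + G.dist s b₁ = G.dist a₁ b₁ → G.dist r s ≤ 1 →
      G.dist r b₀ + G.dist b₀ a₁ + G.dist a₁ s ≤ 1)
    (adj₂ : ∀ r s, G.dist a₁ r + G.dist r b₁ = G.dist a₁ b₁ →
      G.dist a₂ s + G.dist s b₂ = G.dist a₂ b₂ → G.dist r s ≤ 1 →
      G.dist r b₁ + G.dist b₁ a₂ + G.dist a₂ s ≤ 1)
    (adj₃ : ∀ r s, G.dist a₂ r + G.dist r b₂ = G.dist a₂ b₂ →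
      G.dist a₃ s + G.dist s b₃ = G.dist a₃ b₃ → G.dist r s ≤ 1 →
      G.dist r b₂ + G.dist b₂ a₃ + G.dist a₃ s ≤ 1)
    (adj₀ : ∀ r s, G.dist a₃ r + G.dist r b₃ = G.dist a₃ b₃ →
      G.dist a₀ s + G.dist s b₀ = G.dist a₀ b₀ → G.dist r s ≤ 1 →
      G.dist r b₃ + G.dist b₃ a₀ + G.dist a₀ s ≤ 1) :
    G.dist a₀ b₀ + G.dist b₀ a₁ + G.dist a₁ b₁ + G.dist b₁ a₂ + G.dist a₂ b₂ + G.dist b₂ a₃ +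
      G.dist a₃ b₃ + G.dist b₃ a₀ ≤ k := by
  obtain ⟨P₀, p₀⟩ := hc.exists_walk_length_eq_dist a₀ b₀
  obtain ⟨P₁, p₁⟩ := hc.exists_walk_length_eq_dist a₁ b₁
  obtain ⟨P₂, p₂⟩ := hc.exists_walk_length_eq_dist a₂ b₂
  obtain ⟨P₃, p₃⟩ := hc.exists_walk_length_eq_dist a₃ b₃
  obtain ⟨Q₁, q₁⟩ := hc.exists_walk_length_eq_dist b₀ a₁
  obtain ⟨Q₂, q₂⟩ := hc.exists_walk_length_eq_dist b₁ a₂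
  obtain ⟨Q₃, q₃⟩ := hc.exists_walk_length_eq_dist b₂ a₃
  obtain ⟨Q₀, q₀⟩ := hc.exists_walk_length_eq_dist b₃ a₀
  have gd : ∀ {a b : V} (P : G.Walk a b), P.length = G.dist a b → ∀ t ≤ P.length,
      G.dist a (P.getVert t) = t ∧ G.dist (P.getVert t) b = G.dist a b - t := by
    intro a b P hP t ht
    have e1 := dist_getVert_of_length_eq_dist P hP (Nat.zero_le t) ht
    have e2 := dist_getVert_of_length_eq_dist P hP ht le_rfl
    rw [Walk.getVert_zero] at e1
    rw [Walk.getVert_length] at e2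
    omega
  set w : G.Walk a₀ a₀ := P₀.append (Q₁.append (P₁.append (Q₂.append (P₂.append
    (Q₃.append (P₃.append Q₀)))))) with hw
  have hlen : w.length = G.dist a₀ b₀ + G.dist b₀ a₁ + G.dist a₁ b₁ + G.dist b₁ a₂ +
      G.dist a₂ b₂ + G.dist b₂ a₃ + G.dist a₃ b₃ + G.dist b₃ a₀ := by
    simp only [hw, Walk.length_append]
    omega
  -- Connectors have length at most 1, so they have no interior vertices: every index falls on one
  -- of the four geodesics.
  have pos : ∀ i < w.length,
      (∃ t ≤ G.dist a₀ b₀, i = t ∧ w.getVert i = P₀.getVert t) ∨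
      (∃ t ≤ G.dist a₁ b₁, i = G.dist a₀ b₀ + G.dist b₀ a₁ + t ∧ w.getVert i = P₁.getVert t) ∨
      (∃ t ≤ G.dist a₂ b₂, i = G.dist a₀ b₀ + G.dist b₀ a₁ + G.dist a₁ b₁ + G.dist b₁ a₂ + t ∧
        w.getVert i = P₂.getVert t) ∨
      (∃ t ≤ G.dist a₃ b₃, i = G.dist a₀ b₀ + G.dist b₀ a₁ + G.dist a₁ b₁ + G.dist b₁ a₂ +
        G.dist a₂ b₂ + G.dist b₂ a₃ + t ∧ w.getVert i = P₃.getVert t) := by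
    intro i hi
    rcases (show i ≤ G.dist a₀ b₀ ∨ (G.dist a₀ b₀ + G.dist b₀ a₁ ≤ i ∧
        i ≤ G.dist a₀ b₀ + G.dist b₀ a₁ + G.dist a₁ b₁) ∨
        (G.dist a₀ b₀ + G.dist b₀ a₁ + G.dist a₁ b₁ + G.dist b₁ a₂ ≤ i ∧
          i ≤ G.dist a₀ b₀ + G.dist b₀ a₁ + G.dist a₁ b₁ + G.dist b₁ a₂ + G.dist a₂ b₂) ∨
        (G.dist a₀ b₀ + G.dist b₀ a₁ + G.dist a₁ b₁ + G.dist b₁ a₂ + G.dist a₂ b₂ +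
          G.dist b₂ a₃ ≤ i ∧ i ≤ G.dist a₀ b₀ + G.dist b₀ a₁ + G.dist a₁ b₁ + G.dist b₁ a₂ +
          G.dist a₂ b₂ + G.dist b₂ a₃ + G.dist a₃ b₃) by omega) with h | h | h | h
    · refine Or.inl ⟨i, h, rfl, ?_⟩
      rw [hw, Walk.getVert_append', if_pos (by omega)]
    · refine Or.inr (Or.inl ⟨i - (G.dist a₀ b₀ + G.dist b₀ a₁), by omega, by omega, ?_⟩)
      rw [hw, Walk.getVert_append, if_neg (by omega), Walk.getVert_append, if_neg (by omega),
        Walk.getVert_append', if_pos (by omega)]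
      congr 1; omega
    · refine Or.inr (Or.inr (Or.inl ⟨i - (G.dist a₀ b₀ + G.dist b₀ a₁ + G.dist a₁ b₁ +
        G.dist b₁ a₂), by omega, by omega, ?_⟩))
      rw [hw, Walk.getVert_append, if_neg (by omega), Walk.getVert_append, if_neg (by omega),
        Walk.getVert_append, if_neg (by omega), Walk.getVert_append, if_neg (by omega),
        Walk.getVert_append', if_pos (by omega)]
      congr 1; omega
    · refine Or.inr (Or.inr (Or.inr ⟨i - (G.dist a₀ b₀ + G.dist b₀ a₁ + G.dist a₁ b₁ +
        G.dist b₁ a₂ + G.dist a₂ b₂ + G.dist b₂ a₃), by omega, by omega, ?_⟩))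
      rw [hw, Walk.getVert_append, if_neg (by omega), Walk.getVert_append, if_neg (by omega),
        Walk.getVert_append, if_neg (by omega), Walk.getVert_append, if_neg (by omega),
        Walk.getVert_append, if_neg (by omega), Walk.getVert_append, if_neg (by omega),
        Walk.getVert_append', if_pos (by omega)]
      congr 1; omega
  rw [← hlen]
  refine hG.length_le hk w fun i j hij hj he => ?_
  have hd : G.dist (w.getVert i) (w.getVert j) ≤ 1 := by
    rcases he with he | he
    · simp [he]
    · exact (dist_eq_one_iff_adj.2 he).le
  have hd' := hd
  rw [dist_comm] at hd'
  -- Same side: geodesicity applies. Consecutive sides: `adj` bounds the index gap by 1, with `adj₀`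
  -- producing the wrap-around. Opposite sides: `opp` excludes the pair. The remaining cases
  -- contradict `i < j`.
  rcases pos i (by omega) with ⟨t, ht, hi, e⟩ | ⟨t, ht, hi, e⟩ | ⟨t, ht, hi, e⟩ | ⟨t, ht, hi, e⟩ <;>
  rcases pos j hj with ⟨s, hs, hj', e'⟩ | ⟨s, hs, hj', e'⟩ | ⟨s, hs, hj', e'⟩ | ⟨s, hs, hj', e'⟩ <;>
  rw [e, e'] at hd hd'
  · have := dist_getVert_of_length_eq_dist P₀ p₀ (i := t) (j := s) (by omega) (by omega)
    omega
  · have g := gd P₀ p₀ t (by omega)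
    have g' := gd P₁ p₁ s (by omega)
    have := adj₁ _ _ (by omega) (by omega) hd
    omega
  · have g := gd P₀ p₀ t (by omega)
    have g' := gd P₂ p₂ s (by omega)
    have := opp₀ (P₀.getVert t) (P₂.getVert s) (by omega) (by omega)
    omega
  · have g := gd P₀ p₀ t (by omega)
    have g' := gd P₃ p₃ s (by omega)
    have := adj₀ _ _ (by omega) (by omega) hd'
    omega
  · omega
  · have := dist_getVert_of_length_eq_dist P₁ p₁ (i := t) (j := s) (by omega) (by omega)
    omega
  · have g := gd P₁ p₁ t (by omega)
    have g' := gd P₂ p₂ s (by omega)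
    have := adj₂ _ _ (by omega) (by omega) hd
    omega
  · have g := gd P₁ p₁ t (by omega)
    have g' := gd P₃ p₃ s (by omega)
    have := opp₁ (P₁.getVert t) (P₃.getVert s) (by omega) (by omega)
    omega
  · omega
  · omega
  · have := dist_getVert_of_length_eq_dist P₂ p₂ (i := t) (j := s) (by omega) (by omega)
    omega
  · have g := gd P₂ p₂ t (by omega)
    have g' := gd P₃ p₃ s (by omega)
    have := adj₃ _ _ (by omega) (by omega) hd
    omega
  · omega
  · omega
  · omega
  · have := dist_getVert_of_length_eq_dist P₃ p₃ (i := t) (j := s) (by omega) (by omega)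
    omega

/-- In a `k`-chordal graph, four vertices whose opposite intervals are at distance at least `2`
have defect at most `k / 4`. -/
theorem two_mul_diagonals_le {k : ℕ} (hc : G.Connected) (hG : IsKChordal G k) (hk : 3 ≤ k)
    {x u y v : V}
    (opp₀ : ∀ r s, G.dist x r + G.dist r u = G.dist x u →
      G.dist y s + G.dist s v = G.dist y v → 2 ≤ G.dist r s)
    (opp₁ : ∀ r s, G.dist u r + G.dist r y = G.dist u y →
      G.dist v s + G.dist s x = G.dist v x → 2 ≤ G.dist r s) :
    2 * (G.dist x y + G.dist u v) ≤
      (G.dist x u + G.dist y v) + (G.dist u y + G.dist v x) + k := by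
  -- A truncation keeps a middle segment `aᵢbᵢ` of each side and joins consecutive segments by
  -- connectors of length at most 1. A shortest one is chosen, starting from the untruncated
  -- quadrangle.
  let Conf (a₀ b₀ a₁ b₁ a₂ b₂ a₃ b₃ : V) : Prop :=
    (G.dist x a₀ + G.dist a₀ b₀ + G.dist b₀ u = G.dist x u ∧
    G.dist u a₁ + G.dist a₁ b₁ + G.dist b₁ y = G.dist u y ∧
    G.dist y a₂ + G.dist a₂ b₂ + G.dist b₂ v = G.dist y v ∧
    G.dist v a₃ + G.dist a₃ b₃ + G.dist b₃ x = G.dist v x) ∧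
    G.dist b₀ a₁ ≤ 1 ∧ G.dist b₁ a₂ ≤ 1 ∧ G.dist b₂ a₃ ≤ 1 ∧ G.dist b₃ a₀ ≤ 1
  let len (a₀ b₀ a₁ b₁ a₂ b₂ a₃ b₃ : V) : ℕ :=
    G.dist a₀ b₀ + G.dist b₀ a₁ + G.dist a₁ b₁ + G.dist b₁ a₂ + G.dist a₂ b₂ + G.dist b₂ a₃ +
      G.dist a₃ b₃ + G.dist b₃ a₀
  have hex : ∃ L, ∃ a₀ b₀ a₁ b₁ a₂ b₂ a₃ b₃, Conf a₀ b₀ a₁ b₁ a₂ b₂ a₃ b₃ ∧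
      len a₀ b₀ a₁ b₁ a₂ b₂ a₃ b₃ = L :=
    ⟨_, x, u, u, y, y, v, v, x, by simp [Conf], rfl⟩
  classical
  obtain ⟨a₀, b₀, a₁, b₁, a₂, b₂, a₃, b₃, ⟨⟨s₀, s₁, s₂, s₃⟩, c₁, c₂, c₃, c₀⟩, hL⟩ :=
    Nat.find_spec hex
  have hmin : ∀ a₀' b₀' a₁' b₁' a₂' b₂' a₃' b₃', Conf a₀' b₀' a₁' b₁' a₂' b₂' a₃' b₃' →
      len a₀ b₀ a₁ b₁ a₂ b₂ a₃ b₃ ≤ len a₀' b₀' a₁' b₁' a₂' b₂' a₃' b₃' := by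
    intro a₀' b₀' a₁' b₁' a₂' b₂' a₃' b₃' h
    rw [hL]
    exact Nat.find_min' hex ⟨_, _, _, _, _, _, _, _, h, rfl⟩
  have tri := fun a b c => hc.dist_triangle (u := a) (v := b) (w := c)
  -- points of a middle segment lie on the corresponding side
  have seg : ∀ {p q a b r : V}, G.dist p a + G.dist a b + G.dist b q = G.dist p q →
      G.dist a r + G.dist r b = G.dist a b →
      G.dist p r = G.dist p a + G.dist a r ∧ G.dist r q = G.dist r b + G.dist b q := by
    intro p q a b r h1 h2
    have t1 := tri p a r
    have t2 := tri r b q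
    have t3 := tri p r q
    omega
  have hle : len a₀ b₀ a₁ b₁ a₂ b₂ a₃ b₃ ≤ k := by
    apply octagon_le hc hG hk c₁ c₂ c₃ c₀
    · intro r s hr hs
      have e := seg s₀ hr
      have e' := seg s₂ hs
      exact opp₀ r s (by omega) (by omega)
    · intro r s hr hs
      have e := seg s₁ hr
      have e' := seg s₃ hs
      exact opp₁ r s (by omega) (by omega)
    -- Moving the connector to `rs` gives another truncation; minimality says that the replaced
    -- stretch is no longer than `rs`.
    · intro r s hr hs h
      have e := seg s₀ hr
      have e' := seg s₁ hs
      have := hmin a₀ r s b₁ a₂ b₂ a₃ b₃ ⟨⟨by omega, by omega, s₂, s₃⟩, h, c₂, c₃, c₀⟩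
      simp only [len] at this
      omega
    · intro r s hr hs h
      have e := seg s₁ hr
      have e' := seg s₂ hs
      have := hmin a₀ b₀ a₁ r s b₂ a₃ b₃ ⟨⟨s₀, by omega, by omega, s₃⟩, c₁, h, c₃, c₀⟩
      simp only [len] at this
      omega
    · intro r s hr hs h
      have e := seg s₂ hr
      have e' := seg s₃ hs
      have := hmin a₀ b₀ a₁ b₁ a₂ r s b₃ ⟨⟨s₀, s₁, by omega, by omega⟩, c₁, c₂, h, c₀⟩
      simp only [len] at this
      omega
    · intro r s hr hs h
      have e := seg s₃ hr
      have e' := seg s₀ hs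
      have := hmin s b₀ a₁ b₁ a₂ b₂ a₃ r ⟨⟨by omega, s₁, s₂, by omega⟩, c₁, c₂, c₃, h⟩
      simp only [len] at this
      omega
  simp only [len] at hle
  have comm := fun a b => G.dist_comm (u := a) (v := b)
  -- Each diagonal is bounded along both ways around. The four right-hand sides add up to the
  -- perimeter plus the truncated length.
  have x1 : G.dist x y ≤ G.dist x a₀ + G.dist a₀ b₀ + G.dist b₀ a₁ + G.dist a₁ b₁ +
      G.dist b₁ y := by
    have := tri x a₀ y; have := tri a₀ b₀ y; have := tri b₀ a₁ y; have := tri a₁ b₁ y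
    omega
  have x2 : G.dist y x ≤ G.dist y a₂ + G.dist a₂ b₂ + G.dist b₂ a₃ + G.dist a₃ b₃ +
      G.dist b₃ x := by
    have := tri y a₂ x; have := tri a₂ b₂ x; have := tri b₂ a₃ x; have := tri a₃ b₃ x
    omega
  have x3 : G.dist u v ≤ G.dist u a₁ + G.dist a₁ b₁ + G.dist b₁ a₂ + G.dist a₂ b₂ +
      G.dist b₂ v := by
    have := tri u a₁ v; have := tri a₁ b₁ v; have := tri b₁ a₂ v; have := tri a₂ b₂ v
    omega
  have x4 : G.dist v u ≤ G.dist v a₃ + G.dist a₃ b₃ + G.dist b₃ a₀ + G.dist a₀ b₀ +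
      G.dist b₀ u := by
    have := tri v a₃ u; have := tri a₃ b₃ u; have := tri b₃ a₀ u; have := tri a₀ b₀ u
    omega
  rw [comm y x] at x2
  rw [comm v u] at x4
  omega

end Quadrangle

end GraphHyp

namespace GraphHyp

open SimpleGraph

/-! ### Triangles in chordal graphs -/

section Chordal

variable {V : Type*} {G : SimpleGraph V}

/-- In a chordal graph every edge of a closed walk that is traversed only once
lies in a triangle whose third vertex is on the walk. -/
theorem exists_adj_adj_of_walk (hG : IsKChordal G 3) {p q : V} (hpq : G.Adj p q)
    (w : G.Walk p q) (hw : s(p, q) ∉ w.edges) :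
    ∃ b ∈ w.support, G.Adj p b ∧ G.Adj q b := by
  -- Restrict to the support of `w` and delete the edge `pq`. A shortest path from `p` to `q` there,
  -- closed up by `pq`, has no chord, so chordality forces that path to have length 2.
  let G' : SimpleGraph V :=
    { Adj a b := G.Adj a b ∧ s(a, b) ≠ s(p, q) ∧ a ∈ w.support ∧ b ∈ w.support
      symm := ⟨fun a b h => ⟨h.1.symm, by rw [Sym2.eq_swap]; exact h.2.1, h.2.2.2, h.2.2.1⟩⟩
      loopless := ⟨fun a h => h.1.ne rfl⟩ }
  have hle : G' ≤ G := fun a b h => h.1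
  have hadj' : ∀ {a b}, G'.Adj a b ↔
      G.Adj a b ∧ s(a, b) ≠ s(p, q) ∧ a ∈ w.support ∧ b ∈ w.support := Iff.rfl
  have hedges : ∀ e ∈ w.edges, e ∈ G'.edgeSet := by
    intro e he
    induction e using Sym2.ind with
    | _ a b =>
      rw [mem_edgeSet, hadj']
      exact ⟨w.adj_of_mem_edges he, fun h => hw (h ▸ he), w.fst_mem_support_of_mem_edges he,
        w.snd_mem_support_of_mem_edges he⟩
  have hreach : G'.Reachable p q := ⟨w.transfer G' hedges⟩
  obtain ⟨P, hP⟩ := hreach.exists_walk_length_eq_dist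
  have hsupp : ∀ i ≤ P.length, P.getVert i ∈ w.support := by
    intro i hi
    rcases hi.lt_or_eq with hi | rfl
    · exact (P.adj_getVert_succ hi).2.2.1
    · simp
  have hd := fun {i j : ℕ} => dist_getVert_of_length_eq_dist P hP (i := i) (j := j)
  let w' : G.Walk p p := (P.mapLe hle).concat hpq.symm
  have hlen : w'.length = P.length + 1 := by simp [w']
  have hget : ∀ i ≤ P.length, w'.getVert i = P.getVert i := by
    intro i hi
    simp only [w', Walk.concat_eq_append]
    rw [Walk.getVert_append', if_pos (by simpa using hi)]
    simp [Walk.mapLe]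
  have hL : w'.length ≤ 3 := by
    refine hG.length_le le_rfl w' fun i j hij hj he => ?_
    rw [hlen] at hj ⊢
    rw [hget i (by omega), hget j (by omega)] at he
    have hdij := hd hij.le (by omega : j ≤ P.length)
    rcases he with he | he
    · rw [he, dist_self] at hdij
      omega
    · by_cases hs : s(P.getVert i, P.getVert j) = s(p, q)
      · have hi0 := hd (Nat.zero_le i) (by omega)
        have hj0 := hd (Nat.zero_le j) (by omega)
        have hi1 := hd (show i ≤ P.length by omega) le_rfl
        have hj1 := hd (show j ≤ P.length by omega) le_rfl
        rw [Walk.getVert_zero] at hi0 hj0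
        rw [Walk.getVert_length] at hi1 hj1
        rcases Sym2.eq_iff.1 hs with ⟨h1, h2⟩ | ⟨h1, h2⟩
        · rw [h1, dist_self] at hi0
          rw [h2, dist_self] at hj1
          omega
        · rw [h1, dist_self] at hi1
          omega
      · have : G'.Adj (P.getVert i) (P.getVert j) :=
          hadj'.2 ⟨he, hs, hsupp i (by omega), hsupp j (by omega)⟩
        rw [dist_eq_one_iff_adj.2 this] at hdij
        omega
  have h0 : P.length ≠ 0 := fun h => hpq.ne (Walk.eq_of_length_eq_zero h)
  have h1 : P.length ≠ 1 := fun h => by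
    have := P.adj_getVert_succ (i := 0) (by omega)
    rw [Walk.getVert_zero, zero_add, ← h, Walk.getVert_length] at this
    exact this.2.1 rfl
  have h2 : P.length = 2 := by omega
  refine ⟨P.getVert 1, hsupp 1 (by omega), ?_, ?_⟩
  · have := P.adj_getVert_succ (i := 0) (by omega)
    rw [Walk.getVert_zero, zero_add] at this
    exact hle this
  · have := P.adj_getVert_succ (i := 1) (by omega)
    rw [show 1 + 1 = P.length by omega, Walk.getVert_length] at this
    exact (hle this).symm

/-- The triangle condition for chordal graphs. -/
theorem exists_adj_adj_of_dist_eq (hc : G.Connected) (hG : IsKChordal G 3) {p q x : V}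
    (hpq : G.Adj p q) (h : G.dist x p = G.dist x q) :
    ∃ b, G.Adj p b ∧ G.Adj q b ∧ G.dist x b + 1 = G.dist x p := by
  obtain ⟨P, hP⟩ := hc.exists_walk_length_eq_dist p x
  obtain ⟨Q, hQ⟩ := hc.exists_walk_length_eq_dist x q
  have hPs : ∀ z ∈ P.support, G.dist x z + G.dist p z = G.dist x p := fun z hz => by
    have := dist_add_dist_of_mem_support P hP hz
    rw [G.dist_comm (u := x) (v := z), G.dist_comm (u := x) (v := p)]
    omega
  have hQs : ∀ z ∈ Q.support, G.dist x z + G.dist q z = G.dist x q := fun z hz => by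
    have := dist_add_dist_of_mem_support Q hQ hz
    rw [G.dist_comm (u := q) (v := z)]
    omega
  have hpq1 : G.dist p q = 1 := dist_eq_one_iff_adj.2 hpq
  have hqp1 : G.dist q p = 1 := dist_eq_one_iff_adj.2 hpq.symm
  obtain ⟨b, hb, h1, h2⟩ := exists_adj_adj_of_walk hG hpq (P.append Q) (by
    rw [Walk.edges_append, List.mem_append]
    rintro (he | he)
    · have := hPs q (P.snd_mem_support_of_mem_edges he)
      omega
    · have := hQs p (Q.fst_mem_support_of_mem_edges he)
      omega)
  refine ⟨b, h1, h2, ?_⟩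
  have e1 : G.dist p b = 1 := dist_eq_one_iff_adj.2 h1
  have e2 : G.dist q b = 1 := dist_eq_one_iff_adj.2 h2
  rcases Walk.mem_support_append_iff _ _ |>.1 hb with hb | hb
  · have := hPs b hb
    omega
  · have := hQs b hb
    omega

/-- Close `pq` by geodesics through `x` and `v`. If the one from `x` to `v` uses `pq`, the first
alternative holds. Otherwise `pq` lies in a triangle with apex on the closed walk; an apex on an
outer geodesic would bring `q` too close to `x` or `p` too close to `v`. -/
theorem exists_adj_adj_of_dist_succ (hc : G.Connected) (hG : IsKChordal G 3) {p q x v : V}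
    (hpq : G.Adj p q) (hx : G.dist x q = G.dist x p + 1) (hv : G.dist v p = G.dist v q + 1) :
    G.dist x v = G.dist x p + G.dist v q + 1 ∨
      ∃ b, G.Adj p b ∧ G.Adj q b ∧ G.dist x b + G.dist v b = G.dist x v ∧
        G.dist x p ≤ G.dist x b ∧ G.dist v q ≤ G.dist v b := by
  by_cases hxv : G.dist x v = G.dist x p + G.dist v q + 1
  · exact Or.inl hxv
  right
  obtain ⟨P, hP⟩ := hc.exists_walk_length_eq_dist p x
  obtain ⟨Q, hQ⟩ := hc.exists_walk_length_eq_dist x v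
  obtain ⟨R, hR⟩ := hc.exists_walk_length_eq_dist v q
  have comm := fun a b => G.dist_comm (u := a) (v := b)
  have hPs : ∀ z ∈ P.support, G.dist x z + G.dist p z = G.dist x p := fun z hz => by
    have := dist_add_dist_of_mem_support P hP hz
    rw [comm x z, comm x p]
    omega
  have hQs : ∀ z ∈ Q.support, G.dist x z + G.dist v z = G.dist x v := fun z hz => by
    have := dist_add_dist_of_mem_support Q hQ hz
    rw [comm v z]
    omega
  have hRs : ∀ z ∈ R.support, G.dist v z + G.dist q z = G.dist v q := fun z hz => by
    have := dist_add_dist_of_mem_support R hR hz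
    rw [comm q z]
    omega
  have tri := fun a b c => hc.dist_triangle (u := a) (v := b) (w := c)
  obtain ⟨b, hb, h1, h2⟩ := exists_adj_adj_of_walk hG hpq (P.append (Q.append R)) (by
    rw [Walk.edges_append, List.mem_append, Walk.edges_append, List.mem_append]
    rintro (he | he | he)
    · have := hPs q (P.snd_mem_support_of_mem_edges he)
      omega
    · have := hQs q (Q.snd_mem_support_of_mem_edges he)
      omega
    · have := hRs p (R.fst_mem_support_of_mem_edges he)
      omega)
  have e1 : G.dist b p = 1 := dist_eq_one_iff_adj.2 h1.symm
  have e2 : G.dist b q = 1 := dist_eq_one_iff_adj.2 h2.symm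
  have t1 := tri x b q
  have t2 := tri v b p
  rw [Walk.mem_support_append_iff, Walk.mem_support_append_iff] at hb
  rcases hb with hb | hb | hb
  · have := hPs b hb
    rw [comm p b] at this
    omega
  · exact ⟨b, h1, h2, hQs b hb, by omega, by omega⟩
  · have := hRs b hb
    rw [comm q b] at this
    omega

end Chordal

/-! ### Isometric copies and distance tables -/

section Isometric

variable {V W : Type*} {G : SimpleGraph V} {H : SimpleGraph W}

theorem edist_map_le (f : H →g G) (i j : W) : G.edist (f i) (f j) ≤ H.edist i j := by
  by_cases h : H.edist i j = ⊤
  · rw [h]; exact le_top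
  · obtain ⟨p, hp⟩ := exists_walk_of_edist_ne_top h
    rw [← hp, ← p.length_map f]
    exact edist_le _

theorem edist_iso (e : H ≃g G) (i j : W) : G.edist (e i) (e j) = H.edist i j := by
  refine le_antisymm (edist_map_le e.toHom i j) ?_
  simpa using edist_map_le e.symm.toHom (e i) (e j)

/-- Extended distances 0 and 1 detect equality and adjacency, so a map preserving `edist` is
automatically an embedding onto an isometric copy. -/
theorem containsIsometric_iff :
    ContainsIsometric G H ↔ ∃ f : W → V, ∀ i j, G.edist (f i) (f j) = H.edist i j := by
  constructor
  · rintro ⟨S, hS, ⟨e⟩⟩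
    exact ⟨fun i => e i, fun i j => by rw [← hS, edist_iso]⟩
  · rintro ⟨f, hf⟩
    have hadj : ∀ i j, G.Adj (f i) (f j) ↔ H.Adj i j := fun i j => by
      rw [← edist_eq_one_iff_adj, hf, edist_eq_one_iff_adj]
    have hinj : Function.Injective f := fun i j h => by
      rw [← edist_eq_zero_iff (G := H), ← hf, h, edist_self]
    let φ : H →g G := ⟨f, fun {a b} h => (hadj a b).2 h⟩
    let S : G.Subgraph := Subgraph.map φ ⊤
    let e₀ : W ≃ S.verts := Equiv.ofBijective
      (fun i => ⟨f i, by simp [S, φ]⟩)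
      ⟨fun i j h => hinj (congrArg Subtype.val h), fun ⟨z, hz⟩ => by
        simp only [S, Subgraph.map_verts, Subgraph.verts_top, Set.image_univ, Set.mem_range] at hz
        obtain ⟨i, rfl⟩ := hz
        exact ⟨i, rfl⟩⟩
    have he₀ : ∀ i, ((e₀ i : S.verts) : V) = f i := fun i => rfl
    let e : H ≃g S.coe :=
      { toEquiv := e₀
        map_rel_iff' := by
          intro a b
          rw [Subgraph.coe_adj, he₀, he₀]
          simp only [S, Subgraph.map_adj, Relation.Map, Subgraph.top_adj]
          constructor
          · rintro ⟨a', b', h, ha, hb⟩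
            rwa [← hinj ha, ← hinj hb]
          · intro h
            exact ⟨a, b, h, rfl, rfl⟩ }
    refine ⟨S, fun a b => ?_, ⟨e⟩⟩
    obtain ⟨i, rfl⟩ := e.surjective a
    obtain ⟨j, rfl⟩ := e.surjective b
    rw [edist_iso]
    exact (hf i j).symm

/-- `D` is the table of distances of a graph of diameter at most `3`. -/
def IsDistTable {n : ℕ} (H : SimpleGraph (Fin n)) (D : Fin n → Fin n → ℕ) : Prop :=
  ∀ i j, (i = j ∧ D i j = 0) ∨ (H.Adj i j ∧ D i j = 1) ∨
    (i ≠ j ∧ ¬ H.Adj i j ∧ (∃ k, H.Adj i k ∧ H.Adj j k) ∧ D i j = 2) ∨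
    (i ≠ j ∧ ¬ H.Adj i j ∧ (∀ k, ¬ (H.Adj i k ∧ H.Adj j k)) ∧
      (∃ k l, H.Adj i k ∧ H.Adj k l ∧ H.Adj l j) ∧ D i j = 3)

theorem IsDistTable.edist_eq {n : ℕ} {H : SimpleGraph (Fin n)} {D : Fin n → Fin n → ℕ}
    (h : IsDistTable H D) (i j : Fin n) : H.edist i j = D i j := by
  rcases h i j with ⟨rfl, e⟩ | ⟨ha, e⟩ | ⟨hne, hna, ⟨k, hk⟩, e⟩ | ⟨hne, hna, hk, ⟨k, l, h1, h2, h3⟩, e⟩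
  · simp [e]
  · rw [e, Nat.cast_one, edist_eq_one_iff_adj]; exact ha
  · rw [e]
    exact edist_eq_two_iff.2 ⟨hne, hna, ⟨k, hk⟩⟩
  · rw [e]
    refine le_antisymm ?_ ?_
    · exact edist_le (Walk.cons h1 (Walk.cons h2 (Walk.cons h3 Walk.nil)))
    · have : 2 < H.edist i j := two_lt_edist_iff.2 ⟨hne, hna, by
        ext k
        simp only [mem_commonNeighbors, Set.mem_empty_iff_false, iff_false]
        exact hk k⟩
      exact Order.add_one_le_of_lt this

/-- Homomorphisms never increase distances, so only lower bounds remain to be supplied. -/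
theorem IsDistTable.containsIsometric {n : ℕ} {H : SimpleGraph (Fin n)} {D : Fin n → Fin n → ℕ}
    (h : IsDistTable H D) (hc : G.Connected) (f : Fin n → V)
    (hf : ∀ i j, i < j → H.Adj i j → G.Adj (f i) (f j))
    (hD : ∀ i j, i < j → D i j ≤ G.dist (f i) (f j)) : ContainsIsometric G H := by
  have hf' : ∀ i j, H.Adj i j → G.Adj (f i) (f j) := by
    intro i j hij
    rcases lt_trichotomy i j with h' | h' | h'
    · exact hf i j h' hij
    · exact absurd h' hij.ne
    · exact (hf j i h' hij.symm).symm
  have hge : ∀ i j, i < j → H.edist i j ≤ G.edist (f i) (f j) := by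
    intro i j hij
    rw [h.edist_eq, ← (hc (f i) (f j)).coe_dist_eq_edist]
    exact_mod_cast hD i j hij
  refine containsIsometric_iff.2 ⟨f, fun i j => le_antisymm
    (edist_map_le (⟨f, fun {a b} h => hf' a b h⟩ : H →g G) i j) ?_⟩
  rcases lt_trichotomy i j with h' | rfl | h'
  · exact hge i j h'
  · simp
  · rw [edist_comm, G.edist_comm]
    exact hge j i h'

/-- The distances in `C₄`. -/
def distC4 : Fin 4 → Fin 4 → ℕ :=
  ![![0, 1, 2, 1], ![1, 0, 1, 2], ![2, 1, 0, 1], ![1, 2, 1, 0]]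

/-- The distances in `H₁`. -/
def distH1 : Fin 8 → Fin 8 → ℕ :=
  ![![0, 1, 2, 2, 3, 2, 2, 1], ![1, 0, 1, 1, 2, 1, 2, 1], ![2, 1, 0, 1, 2, 2, 3, 2],
    ![2, 1, 1, 0, 1, 1, 2, 2], ![3, 2, 2, 1, 0, 1, 2, 2], ![2, 1, 2, 1, 1, 0, 1, 1],
    ![2, 2, 3, 2, 2, 1, 0, 1], ![1, 1, 2, 2, 2, 1, 1, 0]]

/-- The distances in `H₂`. -/
def distH2 : Fin 8 → Fin 8 → ℕ :=
  ![![0, 1, 2, 2, 3, 2, 2, 1], ![1, 0, 1, 1, 2, 1, 2, 1], ![2, 1, 0, 1, 2, 2, 3, 2],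
    ![2, 1, 1, 0, 1, 1, 2, 1], ![3, 2, 2, 1, 0, 1, 2, 2], ![2, 1, 2, 1, 1, 0, 1, 1],
    ![2, 2, 3, 2, 2, 1, 0, 1], ![1, 1, 2, 1, 2, 1, 1, 0]]

instance : DecidableRel H1.Adj := by unfold H1; infer_instance
instance : DecidableRel H2.Adj := by unfold H2; infer_instance

theorem isDistTable_C4 : IsDistTable C4 distC4 := by unfold IsDistTable; decide

set_option maxRecDepth 10000 in
theorem isDistTable_H1 : IsDistTable H1 distH1 := by unfold IsDistTable; decide +kernel

set_option maxRecDepth 10000 in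
theorem isDistTable_H2 : IsDistTable H2 distH2 := by unfold IsDistTable; decide +kernel

end Isometric

end GraphHyp

namespace GraphHyp

open SimpleGraph

/-! ### Four points with a large diagonal sum -/

section FourPoints

variable {V : Type*} {G : SimpleGraph V}

theorem exists_getVert_of_mem_edges {u v : V} (p : G.Walk u v) {e : Sym2 V} (he : e ∈ p.edges) :
    ∃ n < p.length, e = s(p.getVert n, p.getVert (n + 1)) := by
  induction p with
  | nil => simp at he
  | cons h p ih =>
    rw [Walk.edges_cons, List.mem_cons] at he
    rcases he with rfl | he
    · exact ⟨0, by simp, by simp⟩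
    · obtain ⟨n, hn, h'⟩ := ih he
      exact ⟨n + 1, by simpa using hn, by simpa using h'⟩

theorem containsIsometric_C4 (hc : G.Connected) (h4 : IsKChordal G 4) (h3 : ¬ IsKChordal G 3) :
    ContainsIsometric G C4 := by
  simp only [IsKChordal, not_forall, not_le] at h3
  obtain ⟨u, w, hw, hch, hlt⟩ := h3
  have hlen : w.length = 4 := le_antisymm (h4 u w hw hch) hlt
  have hne : ∀ i j, i < j → j < 4 → w.getVert i ≠ w.getVert j := fun i j hij hj he => by
    have := hw.getVert_injOn' (by simp only [Set.mem_ofPred_eq]; omega)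
      (by simp only [Set.mem_ofPred_eq]; omega) he
    omega
  have hna : ∀ i, i < 2 → ¬ G.Adj (w.getVert i) (w.getVert (i + 2)) := by
    intro i hi ha
    have he := hch.mem_edges (w.getVert_mem_support i) (w.getVert_mem_support (i + 2)) ha
    obtain ⟨n, hn, he⟩ := exists_getVert_of_mem_edges w he
    rw [hlen] at hn
    have h40 : w.getVert 4 = w.getVert 0 := by rw [← hlen]; simp
    have inj : ∀ a < 4, ∀ b < 4, w.getVert a = w.getVert b → a = b := by
      intro a ha' b hb' hab
      rcases lt_trichotomy a b with h | h | h
      · exact absurd hab (hne a b h hb')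
      · exact h
      · exact absurd hab.symm (hne b a h ha')
    rcases (show n + 1 < 4 ∨ n = 3 by omega) with hn' | rfl
    · rcases Sym2.eq_iff.1 he with ⟨h1, h2⟩ | ⟨h1, h2⟩
      · have := inj _ (by omega) _ (by omega) h1
        have := inj _ (by omega) _ (by omega) h2
        omega
      · have := inj _ (by omega) _ (by omega) h1
        have := inj _ (by omega) _ (by omega) h2
        omega
    · rw [h40] at he
      rcases Sym2.eq_iff.1 he with ⟨h1, h2⟩ | ⟨h1, h2⟩
      · have := inj _ (by omega) _ (by omega) h1
        omega
      · have := inj _ (by omega) _ (by omega) h1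
        have := inj _ (by omega) _ (by omega) h2
        omega
  have a0 := w.adj_getVert_succ (i := 0) (by omega)
  have a1 := w.adj_getVert_succ (i := 1) (by omega)
  have a2 := w.adj_getVert_succ (i := 2) (by omega)
  have a3 := w.adj_getVert_succ (i := 3) (by omega)
  rw [show w.getVert (3 + 1) = w.getVert 0 by rw [show 3 + 1 = w.length from hlen.symm]; simp] at a3
  have d02 := hc.one_lt_dist_of_ne_of_not_adj (hne 0 2 (by omega) (by omega)) (hna 0 (by omega))
  have d13 := hc.one_lt_dist_of_ne_of_not_adj (hne 1 3 (by omega) (by omega)) (hna 1 (by omega))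
  have d01 := (dist_eq_one_iff_adj.2 a0).ge
  have d12 := (dist_eq_one_iff_adj.2 a1).ge
  have d23 := (dist_eq_one_iff_adj.2 a2).ge
  have d03 := (dist_eq_one_iff_adj.2 a3.symm).ge
  refine isDistTable_C4.containsIsometric hc (fun i => w.getVert i) ?_ ?_
  · intro i j hij ha
    fin_cases i <;> fin_cases j <;> first
      | exact absurd hij (by decide)
      | exact absurd ha (by decide)
      | assumption
      | exact a3.symm
  · intro i j hij
    fin_cases i <;> fin_cases j <;> first
      | exact absurd hij (by decide)
      | assumption

/-- By `h₂`, both diagonals have geodesics through `pq`. Triangles `pqb` and `pqc` point towards the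
sides `xv` and `uy`; on each of `pb`, `pc`, `qc`, `qb` stands a triangle whose apex is one step
closer to `x`, `u`, `y`, `v` respectively. Only the adjacency of `b` and `c` stays open, separating
`H1` from `H2`. -/
theorem containsIsometric_of_adj (hc : G.Connected) (hG : IsKChordal G 3) {x u y v p q : V}
    (hp : G.dist x p + G.dist p u = G.dist x u) (hq : G.dist y q + G.dist q v = G.dist y v)
    (hpq : G.Adj p q)
    (h₂ : G.dist x u + G.dist y v + 2 ≤ G.dist x y + G.dist u v)
    (h₃ : G.dist u y + G.dist v x + 2 ≤ G.dist x y + G.dist u v) :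
    ContainsIsometric G H1 ∨ ContainsIsometric G H2 := by
  have comm := fun a b => G.dist_comm (u := a) (v := b)
  have tri := fun a b c => hc.dist_triangle (u := a) (v := b) (w := c)
  have adj : ∀ {a b}, G.Adj a b → G.dist a b = 1 := fun h => dist_eq_one_iff_adj.2 h
  have hpq1 := adj hpq
  have hqp1 := adj hpq.symm
  rw [comm p u] at hp
  rw [comm q v] at hq
  rw [comm v x] at h₃
  -- position of the edge `pq`
  have hpos : G.dist x q = G.dist x p + 1 ∧ G.dist y p = G.dist y q + 1 ∧
      G.dist u q = G.dist u p + 1 ∧ G.dist v p = G.dist v q + 1 ∧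
      G.dist x y = G.dist x p + 1 + G.dist y q ∧ G.dist u v = G.dist u p + 1 + G.dist v q := by
    have := tri x p q; have := tri x q y; have := tri x p y
    have := tri u p q; have := tri u q v; have := tri u p v
    have := tri y q p; have := tri v q p
    rw [comm q y, comm q v, comm p y, comm p v] at *
    omega
  obtain ⟨xq, yp, uq, vp, xy, uv⟩ := hpos
  have fb := exists_adj_adj_of_dist_succ hc hG hpq xq vp
  have fc := exists_adj_adj_of_dist_succ hc hG hpq uq yp
  -- By `h₃`, `uy + vx` is at most `xp + vq + up + yq`, while `fb` and `fc` give the reverse bound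
  -- termwise. Hence the first alternatives fail and `b`, `c` have the least possible distances.
  obtain ⟨b, pb, qb, hb⟩ : ∃ b, G.Adj p b ∧ G.Adj q b ∧ G.dist x b = G.dist x p ∧
      G.dist v b = G.dist v q ∧ G.dist x v = G.dist x p + G.dist v q := by
    rcases fb with fb | ⟨b, pb, qb, hb⟩
    · rcases fc with fc | ⟨c, pc, qc, hc'⟩ <;> omega
    · refine ⟨b, pb, qb, ?_⟩
      rcases fc with fc | ⟨c, pc, qc, hc'⟩ <;> omega
  obtain ⟨c, pc, qc, hc'⟩ : ∃ c, G.Adj p c ∧ G.Adj q c ∧ G.dist u c = G.dist u p ∧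
      G.dist y c = G.dist y q ∧ G.dist u y = G.dist u p + G.dist y q := by
    rcases fc with fc | ⟨c, pc, qc, hc'⟩
    · omega
    · exact ⟨c, pc, qc, by omega⟩
  obtain ⟨x', px, bx, hx⟩ := exists_adj_adj_of_dist_eq hc hG pb hb.1.symm
  obtain ⟨u', pu, cu, hu⟩ := exists_adj_adj_of_dist_eq hc hG pc hc'.1.symm
  obtain ⟨y', qy, cy, hy⟩ := exists_adj_adj_of_dist_eq hc hG qc hc'.2.1.symm
  obtain ⟨v', qv, bv, hv⟩ := exists_adj_adj_of_dist_eq hc hG qb hb.2.1.symm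
  -- the distances that have to be bounded from below
  have lower : ∀ {s t s' t' : V}, G.dist s t ≤ G.dist s s' + G.dist s' t' + G.dist t t' := by
    intro s t s' t'
    have := tri s s' t
    have := tri s' t' t
    rw [comm t t']
    omega
  -- All these bounds come from detours: a shorter distance between two of the eight vertices would
  -- shorten a known distance between corners.
  have dxu : 2 ≤ G.dist x' u' := by have := lower (s := x) (t := u) (s' := x') (t' := u'); omega
  have dxc : 2 ≤ G.dist x' c := by have := lower (s := x) (t := y) (s' := x') (t' := c); omega
  have dxy : 3 ≤ G.dist x' y' := by have := lower (s := x) (t := y) (s' := x') (t' := y'); omega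
  have dxq : 2 ≤ G.dist x' q := by have := lower (s := x) (t := y) (s' := x') (t' := q); omega
  have dxv : 2 ≤ G.dist x' v' := by have := lower (s := x) (t := v) (s' := x') (t' := v'); omega
  have dpy : 2 ≤ G.dist p y' := by have := lower (s := x) (t := y) (s' := p) (t' := y'); omega
  have dpv : 2 ≤ G.dist p v' := by have := lower (s := u) (t := v) (s' := p) (t' := v'); omega
  have duy : 2 ≤ G.dist u' y' := by have := lower (s := u) (t := y) (s' := u') (t' := y'); omega
  have duq : 2 ≤ G.dist u' q := by have := lower (s := u) (t := v) (s' := u') (t' := q); omega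
  have duv : 3 ≤ G.dist u' v' := by have := lower (s := u) (t := v) (s' := u') (t' := v'); omega
  have dub : 2 ≤ G.dist u' b := by have := lower (s := u) (t := v) (s' := u') (t' := b); omega
  have dcv : 2 ≤ G.dist c v' := by have := lower (s := u) (t := v) (s' := c) (t' := v'); omega
  have dcb : 1 ≤ G.dist c b := by have := lower (s := u) (t := v) (s' := c) (t' := b); omega
  have dyv : 2 ≤ G.dist y' v' := by have := lower (s := y) (t := v) (s' := y') (t' := v'); omega
  have dyb : 2 ≤ G.dist y' b := by
    have := lower (s := y) (t := x) (s' := y') (t' := b)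
    rw [comm y x] at this
    omega
  have one : ∀ {a b}, G.Adj a b → 1 ≤ G.dist a b := fun h => (adj h).ge
  have px := px.symm
  have e1 := one px; have e2 := one pu; have e3 := one cu.symm; have e4 := one cy
  have e5 := one qy.symm; have e6 := one qv; have e7 := one bv.symm; have e8 := one bx.symm
  have e9 := one pb; have e10 := one qb; have e11 := one qc.symm; have e12 := one pc
  have e13 := one hpq
  have cu := cu.symm; have qy := qy.symm; have bv := bv.symm; have bx := bx.symm
  have qc := qc.symm
  by_cases hcb : G.Adj c b
  · right
    refine isDistTable_H2.containsIsometric hc ![x', p, u', c, y', q, v', b] ?_ ?_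
    · intro i j hij ha
      fin_cases i <;> fin_cases j <;> first
        | exact absurd hij (by decide)
        | exact absurd ha (by decide)
        | assumption
    · intro i j hij
      fin_cases i <;> fin_cases j <;> first
        | exact absurd hij (by decide)
        | assumption
  · left
    have dcb := hc.one_lt_dist_of_ne_of_not_adj (u := c) (v := b)
      (fun h => by rw [h, dist_self] at dcb; omega) hcb
    refine isDistTable_H1.containsIsometric hc ![x', p, u', c, y', q, v', b] ?_ ?_
    · intro i j hij ha
      fin_cases i <;> fin_cases j <;> first
        | exact absurd hij (by decide)
        | exact absurd ha (by decide)
        | assumption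
    · intro i j hij
      fin_cases i <;> fin_cases j <;> first
        | exact absurd hij (by decide)
        | assumption

theorem containsIsometric_of_chordal (hc : G.Connected) (hG : IsKChordal G 3) {x u y v : V}
    (h₂ : G.dist x u + G.dist y v + 2 ≤ G.dist x y + G.dist u v)
    (h₃ : G.dist u y + G.dist v x + 2 ≤ G.dist x y + G.dist u v) :
    ContainsIsometric G H1 ∨ ContainsIsometric G H2 := by
  have comm := fun a b => G.dist_comm (u := a) (v := b)
  have tri := fun a b c => hc.dist_triangle (u := a) (v := b) (w := c)
  by_contra hcon
  have key := two_mul_diagonals_le hc hG le_rfl (x := x) (u := u) (y := y) (v := v) ?_ ?_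
  · omega
  · intro r s hr hs
    by_contra hlt
    refine hcon (containsIsometric_of_adj hc hG hr hs ?_ h₂ h₃)
    have := tri x r y; have := tri r s y; have := tri u r v; have := tri r s v
    rw [← dist_eq_one_iff_adj]
    rw [comm s y, comm u r] at *
    omega
  · intro r s hr hs
    by_contra hlt
    -- The other pair of opposite sides reduces to the first after exchanging `x` and `y`.
    rw [comm u y, comm v x] at *
    refine hcon (containsIsometric_of_adj hc hG (x := y) (u := u) (y := x) (v := v) (p := r)
      (q := s) ?_ ?_ ?_ ?_ ?_)
    · rw [comm y r, comm r u]; omega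
    · rw [comm x s, comm s v]; omega
    · have := tri y r x; have := tri r s x; have := tri u r v; have := tri r s v
      rw [← dist_eq_one_iff_adj]
      rw [comm y r, comm y x, comm s v] at *
      omega
    · rw [comm y x]; omega
    · rw [comm y x, comm u x, comm v y]; omega

theorem diagonals_le (hc : G.Connected) (hG : IsKChordal G 4) (x y u v : V) :
    G.dist x y + G.dist u v ≤
      max (G.dist x u + G.dist y v) (G.dist u y + G.dist v x) + 2 := by
  have comm := fun a b => G.dist_comm (u := a) (v := b)
  have tri := fun a b c => hc.dist_triangle (u := a) (v := b) (w := c)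
  by_contra hlt
  have key := two_mul_diagonals_le hc hG (by omega) (x := x) (u := u) (y := y) (v := v) ?_ ?_
  · omega
  · intro r s hr hs
    have := tri x r y; have := tri r s y; have := tri u r v; have := tri r s v
    rw [comm s y, comm u r] at *
    omega
  · intro r s hr hs
    have := tri y r x; have := tri r s x; have := tri u r v; have := tri r s v
    rw [comm y r, comm y x, comm s v] at *
    omega

end FourPoints

/-! ### Translation to hyperbolicity -/

section Hyperbolicity

variable {V W : Type*} {G : SimpleGraph V}

theorem largest_sub_secondLargest_le_iff {r s t δ : ℝ} (hδ : 0 ≤ δ) :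
    largest r s t - secondLargest r s t ≤ δ ↔
      r ≤ max s t + δ ∧ s ≤ max r t + δ ∧ t ≤ max r s + δ := by
  unfold largest secondLargest
  rcases le_total r s with h1 | h1 <;> rcases le_total s t with h2 | h2 <;>
    rcases le_total r t with h3 | h3 <;> simp only [h1, h2, h3, max_eq_left, max_eq_right,
      min_eq_left, min_eq_right, max_self] <;> constructor <;> intro h <;>
    first
      | (refine ⟨?_, ?_, ?_⟩ <;> linarith)
      | (obtain ⟨h4, h5, h6⟩ := h; linarith)

/-- Permuting the vertices permutes the three distance sums, so one inequality over all quadruples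
suffices, and doubling makes it integral. -/
theorem isHyperbolic_iff (G : SimpleGraph V) (n : ℕ) :
    IsHyperbolic G ((n : ℝ) / 2) ↔ ∀ x y u v : V, G.dist x y + G.dist u v ≤
      max (G.dist x u + G.dist y v) (G.dist u y + G.dist v x) + n := by
  have comm := fun a b => G.dist_comm (u := a) (v := b)
  have cast : ∀ {a b c d e f : ℕ}, (((a : ℝ) + b) / 2 ≤
      max (((c : ℝ) + d) / 2) (((e : ℝ) + f) / 2) + (n : ℝ) / 2) ↔
      a + b ≤ max (c + d) (e + f) + n := by
    intro a b c d e f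
    rw [max_div_div_right (by norm_num), ← add_div, div_le_div_iff_of_pos_right (by norm_num)]
    exact_mod_cast Iff.rfl
  unfold IsHyperbolic defect
  simp only [largest_sub_secondLargest_le_iff (show (0 : ℝ) ≤ n / 2 by positivity), cast]
  constructor
  · intro h x y u v
    have := (h x y u v).1
    rw [comm u x, comm v y] at this
    omega
  · intro h x y u v
    have h1 := h x y u v
    have h2 := h x u v y
    have h3 := h x v u y
    simp only [comm y x, comm u x, comm v y, comm v x, comm u y, comm v u] at *
    omega

theorem not_isHyperbolic_of_containsIsometric {H : SimpleGraph W} (hc : G.Connected)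
    (h : ContainsIsometric G H) {x y u v : W} {n : ℕ}
    (hH : max (H.edist x u + H.edist y v) (H.edist u y + H.edist v x) + n <
      H.edist x y + H.edist u v) :
    ¬ IsHyperbolic G ((n : ℝ) / 2) := by
  obtain ⟨f, hf⟩ := containsIsometric_iff.1 h
  rw [isHyperbolic_iff]
  intro hyp
  have := hyp (f x) (f y) (f u) (f v)
  simp only [← hf, ← (hc _ _).coe_dist_eq_edist] at hH
  have hmax : ∀ a b : ℕ, max (a : ℕ∞) b = ((max a b : ℕ) : ℕ∞) :=
    fun a b => (Nat.mono_cast.map_max).symm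
  simp only [← Nat.cast_add, hmax, Nat.cast_lt] at hH
  omega

/-- Being `n / 2`-hyperbolic is monotone in `n`, so failure at `n = 1` also rules out `n = 0`. -/
theorem hyperbolicity_eq_one_iff (h : IsHyperbolic G 1) :
    hyperbolicity G = 1 ↔ ¬ IsHyperbolic G (((1 : ℕ) : ℝ) / 2) := by
  have hle : hyperbolicity G ≤ 1 := sInf_le ⟨2, by
    rw [Nat.cast_ofNat, ENNReal.div_self (by norm_num) (by norm_num)], by norm_num; exact h⟩
  constructor
  · intro he hyp
    have : hyperbolicity G ≤ ((1 : ℕ) : ℝ≥0∞) / 2 := sInf_le ⟨1, rfl, hyp⟩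
    rw [he, Nat.cast_one, one_div] at this
    exact absurd this (not_le.2 (ENNReal.inv_lt_one.2 (by norm_num)))
  · intro hyp
    refine le_antisymm hle (le_sInf ?_)
    rintro _ ⟨n, rfl, hn⟩
    have h2 : 2 ≤ n := by
      by_contra hlt
      refine hyp fun x y u v => (hn x y u v).trans ?_
      have : n ≤ 1 := by omega
      gcongr
    rw [ENNReal.le_div_iff_mul_le (by norm_num) (by norm_num), one_mul]
    exact_mod_cast h2

end Hyperbolicity

end GraphHyp

/-! ### The corollary -/

theorem corollary7 {V : Type*} (G : SimpleGraph V) (hG : G.Connected)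
    (h4 : GraphHyp.IsKChordal G 4) :
    GraphHyp.IsHyperbolic G 1 ∧
      (GraphHyp.hyperbolicity G = 1 ↔
        GraphHyp.ContainsIsometric G GraphHyp.C4 ∨
        GraphHyp.ContainsIsometric G GraphHyp.H1 ∨
        GraphHyp.ContainsIsometric G GraphHyp.H2) := by
  have h1 : GraphHyp.IsHyperbolic G 1 := by
    have := (GraphHyp.isHyperbolic_iff G 2).2 (GraphHyp.diagonals_le hG h4)
    norm_num at this
    exact this
  refine ⟨h1, ?_⟩
  rw [GraphHyp.hyperbolicity_eq_one_iff h1]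
  constructor
  · intro hyp
    by_cases h3 : GraphHyp.IsKChordal G 3
    · right
      rw [GraphHyp.isHyperbolic_iff] at hyp
      push Not at hyp
      -- Integrality turns an excess above 1 into an excess of at least 2.
      obtain ⟨x, y, u, v, hlt⟩ := hyp
      exact GraphHyp.containsIsometric_of_chordal hG h3 (x := x) (u := u) (y := y) (v := v)
        (by omega) (by omega)
    · exact Or.inl (GraphHyp.containsIsometric_C4 hG h4 h3)
  · rintro (h | h | h)
    -- The diagonal sum is `2 + 2` against `1 + 1` in `C4`, and `3 + 3` against `2 + 2` in `H1` and
    -- `H2`.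
    · apply GraphHyp.not_isHyperbolic_of_containsIsometric hG h (x := 0) (y := 2) (u := 1) (v := 3)
      simp only [GraphHyp.isDistTable_C4.edist_eq]
      exact_mod_cast (by decide)
    · apply GraphHyp.not_isHyperbolic_of_containsIsometric hG h (x := 0) (y := 4) (u := 2) (v := 6)
      simp only [GraphHyp.isDistTable_H1.edist_eq]
      exact_mod_cast (by decide)
    · apply GraphHyp.not_isHyperbolic_of_containsIsometric hG h (x := 0) (y := 4) (u := 2) (v := 6)
      simp only [GraphHyp.isDistTable_H2.edist_eq]
      exact_mod_cast (by decide)
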